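/- Let $H$ and $K$ be infinite-dimensional separable complex Hilbert spaces, and let $A\in B(H)$, $B\in B(K)$ be bounded linear operators. For a bounded operator $C\in B(K,H)$ let $M_C=\begin{pmatrix}A&C\\0&B\end{pmatrix}$ act on $H\oplus K$. For a bounded operator $T$ from $X$ to $Y$ write $N(T)$ and $R(T)$ for its kernel and range, $\alpha(T)=\dim N(T)$ and $\beta(T)=\dim Y/R(T)$, both in $\{0,1,2,\dots\}\cup\{\infty\}$; $T$ is *Fredholm* if $\alpha(T)<\infty$ and $\beta(T)<\infty$. For $T\in B(X)$ let $\operatorname{asc}(T)=\inf\{k\ge 0:N(T^k)=N(T^{k+1})\}$ and $\operatorname{des}(T)=\inf\{k\ge 0:R(T^k)=R(T^{k+1})\}$, with $\inf\emptyset=\infty$. The operator $T\in B(X)$ is *Browder* if it is Fredholm and $\operatorname{asc}(T)=\operatorname{des}(T)<\infty$; it is *left semi-Browder* if $R(T)$ is closed and complemented, $\alpha(T)<\infty$ and $\operatorname{asc}(T)<\infty$; it is *right semi-Browder* if $N(T)$ is closed and complemented, $\beta(T)<\infty$ and $\operatorname{des}(T)<\infty$. Let $\sigma_b(T)$, $\sigma_{lb}(T)$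 and $\sigma_{rb}(T)$ be the sets of $\lambda\in\mathbb C$ for which $T-\lambda$ is not Browder, not left semi-Browder and not right semi-Browder, respectively. Let $G(K,H)$ be the set of invertible operators in $B(K,H)$ and $\Phi(K,H)$ the set of Fredholm operators in $B(K,H)$. Then $$\bigcap_{C\in G(K,H)}\sigma_b(M_C)=\bigcap_{C\in\Phi(K,H)}\sigma_b(M_C)=\sigma_{lb}(A)\cup\sigma_{rb}(B)\cup\{\lambda\in\mathbb C:\alpha(A-\lambda)+\alpha(B-\lambda)\neq\beta(A-\lambda)+\beta(B-\lambda)\},$$ where sums are taken in $\{0,1,2,\dots\}\cup\{\infty\}$ (so $\infty=\infty$ counts as equality). -/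

import Mathlib

/-! Browder-type operators and spectra, and upper triangular operator matrices. -/

namespace BrowderPerturbation

noncomputable section

variable {X Y : Type*} [NormedAddCommGroup X] [NormedSpace ℂ X]
  [NormedAddCommGroup Y] [NormedSpace ℂ Y]

/-- The dimension of a complex vector space as an extended natural number:
every infinite dimension counts as `⊤`. -/
def dim (V : Type*) [AddCommGroup V] [Module ℂ V] : ℕ∞ :=
  Cardinal.toENat (Module.rank ℂ V)

/-- The nullity `α(T) = dim N(T)`. -/
def nullity (T : X →L[ℂ] Y) : ℕ∞ :=
  dim (LinearMap.ker (T : X →ₗ[ℂ] Y))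

/-- The deficiency `β(T) = dim Y / R(T)` (algebraic quotient). -/
def deficiency (T : X →L[ℂ] Y) : ℕ∞ :=
  dim (Y ⧸ LinearMap.range (T : X →ₗ[ℂ] Y))

/-- The ascent `inf {k | N(T^k) = N(T^(k+1))}`, equal to `⊤` if there is no such `k`. -/
def ascent (T : X →L[ℂ] X) : ℕ∞ :=
  ⨅ k ∈ {k : ℕ | LinearMap.ker ((T ^ k : X →L[ℂ] X) : X →ₗ[ℂ] X) =
    LinearMap.ker ((T ^ (k + 1) : X →L[ℂ] X) : X →ₗ[ℂ] X)}, (k : ℕ∞)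

/-- The descent `inf {k | R(T^k) = R(T^(k+1))}`, equal to `⊤` if there is no such `k`. -/
def descent (T : X →L[ℂ] X) : ℕ∞ :=
  ⨅ k ∈ {k : ℕ | LinearMap.range ((T ^ k : X →L[ℂ] X) : X →ₗ[ℂ] X) =
    LinearMap.range ((T ^ (k + 1) : X →L[ℂ] X) : X →ₗ[ℂ] X)}, (k : ℕ∞)

/-- `T` is Fredholm: `α(T) < ∞` and `β(T) < ∞`. -/
def IsFredholm (T : X →L[ℂ] Y) : Prop :=
  nullity T < ⊤ ∧ deficiency T < ⊤

/-- `T` is left semi-Fredholm: `R(T)` is closed and complemented, and `α(T) < ∞`. -/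
def IsLeftSemiFredholm (T : X →L[ℂ] X) : Prop :=
  IsClosed (LinearMap.range (T : X →ₗ[ℂ] X) : Set X) ∧
    (LinearMap.range (T : X →ₗ[ℂ] X)).ClosedComplemented ∧ nullity T < ⊤

/-- `T` is right semi-Fredholm: `N(T)` is closed and complemented, and `β(T) < ∞`. -/
def IsRightSemiFredholm (T : X →L[ℂ] X) : Prop :=
  IsClosed (LinearMap.ker (T : X →ₗ[ℂ] X) : Set X) ∧
    (LinearMap.ker (T : X →ₗ[ℂ] X)).ClosedComplemented ∧ deficiency T < ⊤

/-- `T` is Browder: Fredholm, with equal finite ascent and descent. -/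
def IsBrowder (T : X →L[ℂ] X) : Prop :=
  IsFredholm T ∧ ascent T = descent T ∧ ascent T < ⊤

/-- `T` is left semi-Browder: left semi-Fredholm with finite ascent. -/
def IsLeftSemiBrowder (T : X →L[ℂ] X) : Prop :=
  IsLeftSemiFredholm T ∧ ascent T < ⊤

/-- `T` is right semi-Browder: right semi-Fredholm with finite descent. -/
def IsRightSemiBrowder (T : X →L[ℂ] X) : Prop :=
  IsRightSemiFredholm T ∧ descent T < ⊤

/-- The operator `T - λ`. -/
def shift (T : X →L[ℂ] X) (l : ℂ) : X →L[ℂ] X :=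
  T - l • ContinuousLinearMap.id ℂ X

/-- The Browder spectrum `σ_b(T)`. -/
def browderSpectrum (T : X →L[ℂ] X) : Set ℂ :=
  {l | ¬ IsBrowder (shift T l)}

/-- The left semi-Browder spectrum `σ_lb(T)`. -/
def leftBrowderSpectrum (T : X →L[ℂ] X) : Set ℂ :=
  {l | ¬ IsLeftSemiBrowder (shift T l)}

/-- The right semi-Browder spectrum `σ_rb(T)`. -/
def rightBrowderSpectrum (T : X →L[ℂ] X) : Set ℂ :=
  {l | ¬ IsRightSemiBrowder (shift T l)}

variable {H K : Type*} [NormedAddCommGroup H] [InnerProductSpace ℂ H]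
  [NormedAddCommGroup K] [InnerProductSpace ℂ K]

/-- The operator matrix `M_C = [A C; 0 B]`, that is `(x, y) ↦ (A x + C y, B y)`,
on the Hilbert space direct sum `H ⊕ K`. -/
def upperTriangular (A : H →L[ℂ] H) (B : K →L[ℂ] K) (C : K →L[ℂ] H) :
    WithLp 2 (H × K) →L[ℂ] WithLp 2 (H × K) :=
  ((WithLp.prodContinuousLinearEquiv 2 ℂ H K).symm : H × K →L[ℂ] WithLp 2 (H × K)) ∘L
    ((A.coprod C).prod (B ∘L ContinuousLinearMap.snd ℂ H K)) ∘L
    ((WithLp.prodContinuousLinearEquiv 2 ℂ H K) : WithLp 2 (H × K) →L[ℂ] H × K)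

theorem upperTriangular_apply (A : H →L[ℂ] H) (B : K →L[ℂ] K) (C : K →L[ℂ] H)
    (x : H) (y : K) :
    upperTriangular A B C (WithLp.toLp 2 (x, y)) = WithLp.toLp 2 (A x + C y, B y) := rfl

end

end BrowderPerturbation

/-!
Subtracting `λ` from `M_C` subtracts it from `A` and `B`, so one may take `λ = 0`.

If `M_C` is Browder for some `C`, its index is zero. The index formula for the factorization of
`M_C` into `diag(A, I)` and `[I C; 0 B]` (`index_upperTriangular`) is an identity in
`{0, 1, 2, ...} ∪ {∞}`, from which the finite and equal nullity and deficiency of `M_C` can be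
cancelled; this gives `α(A) + α(B) = β(A) + β(B)`. The remaining properties of `A` and `B` follow
since `A` is a restriction of `M_C` and `B` a quotient of it (`IsBrowder.of_upperTriangular`).

Conversely, let `N = N(A ^ p)` and `L = R(B ^ q)` be the stable kernel of `A` and the stable range
of `B`. On `N ⊕ 0` and on the quotient by `H ⊕ L`, both finite-dimensional, `M_C` is nilpotent.
Between them, on `(H ⊕ L) / (N ⊕ 0)`, it is bijective as soon as `C` maps `N(B) ∩ L`
isomorphically onto a complement of `R(A) + N`, and then `M_C` is Browder
(`isBrowder_upperTriangular`). Stability gives `β(A) = α(A) + dim H / (R(A) + N)` and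
`α(B) = β(B) + dim (N(B) ∩ L)` (`dim_ker_add_dim_quotient_sup`, `dim_ker_inf_add_dim_quotient`), so
the balance of nullities and deficiencies says precisely that the two spaces have equal dimension.
As their orthogonal complements are both infinite-dimensional and separable, an isomorphism between
them extends to an invertible `C : K → H`
(`exists_isInvertible_isBrowder_upperTriangular`). No distinction between finite and infinite
deficiency of `A` is needed.
-/

namespace BrowderPerturbation
open Submodule

/-! ### Dimension counting in the extended natural numbers -/

theorem enat_add_left_cancel {a b c : ℕ∞} (ha : a ≠ ⊤) (h : a + b = a + c) : b = c :=
  ENat.add_right_injective_of_ne_top ha h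

theorem enat_add_right_cancel {a b c : ℕ∞} (ha : a ≠ ⊤) (h : b + a = c + a) : b = c :=
  ENat.add_left_injective_of_ne_top ha h

section Dim
variable {V V' V'' : Type*} [AddCommGroup V] [Module ℂ V] [AddCommGroup V'] [Module ℂ V']
  [AddCommGroup V''] [Module ℂ V'']

theorem dim_eq_length (V : Type*) [AddCommGroup V] [Module ℂ V] : dim V = Module.length ℂ V :=
  (Module.length_eq_rank ℂ V).symm

theorem dim_congr (e : V ≃ₗ[ℂ] V') : dim V = dim V' := by
  rw [dim_eq_length, dim_eq_length, e.length_eq]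

theorem dim_le_of_injective (f : V →ₗ[ℂ] V') (hf : Function.Injective f) : dim V ≤ dim V' := by
  rw [dim_eq_length, dim_eq_length]
  exact Module.length_le_of_injective f hf

theorem dim_le_of_surjective (f : V →ₗ[ℂ] V') (hf : Function.Surjective f) : dim V' ≤ dim V := by
  rw [dim_eq_length, dim_eq_length]
  exact Module.length_le_of_surjective f hf

theorem dim_submodule_mono {p q : Submodule ℂ V} (h : p ≤ q) : dim p ≤ dim q :=
  dim_le_of_injective (inclusion h) (inclusion_injective h)

theorem dim_quotient_anti {p q : Submodule ℂ V} (h : p ≤ q) : dim (V ⧸ q) ≤ dim (V ⧸ p) :=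
  dim_le_of_surjective (factor h) (factor_surjective h)

theorem dim_lt_top_iff : dim V < ⊤ ↔ FiniteDimensional ℂ V := by
  rw [dim, lt_top_iff_ne_top, Ne, Cardinal.toENat_eq_top, not_le, Module.rank_lt_aleph0_iff]

theorem dim_ker_add_dim_range (f : V →ₗ[ℂ] V') :
    dim (LinearMap.ker f) + dim (LinearMap.range f) = dim V := by
  simp only [dim_eq_length]
  exact (Module.length_eq_add_of_exact (LinearMap.ker f).subtype f.rangeRestrict
    (subtype_injective _) f.surjective_rangeRestrict
    (LinearMap.exact_iff.2 (by simp))).symm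

theorem dim_add_dim_quotient (p : Submodule ℂ V) : dim p + dim (V ⧸ p) = dim V := by
  simp only [dim_eq_length]
  exact (Module.length_eq_add_of_exact p.subtype p.mkQ (subtype_injective _) (mkQ_surjective _)
    (LinearMap.exact_subtype_mkQ p)).symm

/-- The image of `p` in `V ⧸ q` is `p / (p ⊓ q)`. -/
theorem dim_inf_add_dim_map_mkQ (p q : Submodule ℂ V) :
    dim (p ⊓ q : Submodule ℂ V) + dim (p.map q.mkQ) = dim p := by
  rw [← dim_ker_add_dim_range (q.mkQ.domRestrict p), LinearMap.range_domRestrict,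
    LinearMap.ker_domRestrict, ker_mkQ, dim_congr (equivSubtypeMap p (q.comap p.subtype)),
    map_comap_subtype]

/-- The image of `p` in `V ⧸ q` is `(q ⊔ p) / q`, with quotient `V ⧸ (q ⊔ p)`. -/
theorem dim_map_mkQ_add_dim_quotient_sup (p q : Submodule ℂ V) :
    dim (p.map q.mkQ) + dim (V ⧸ (q ⊔ p)) = dim (V ⧸ q) := by
  rw [← dim_add_dim_quotient (p.map q.mkQ),
    ← dim_congr (quotientQuotientEquivQuotient q (q ⊔ p) le_sup_left), Submodule.map_sup,
    mkQ_map_self, bot_sup_eq]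

theorem dim_quotient_comap (f : V →ₗ[ℂ] V') (p : Submodule ℂ V') (hf : Function.Surjective f) :
    dim (V ⧸ p.comap f) = dim (V' ⧸ p) := by
  rw [← dim_congr ((p.mkQ ∘ₗ f).quotKerEquivOfSurjective ((mkQ_surjective _).comp hf)),
    LinearMap.ker_comp, ker_mkQ]

/-- `N(ST) / N(T)` is isomorphic to `N(S) ∩ R(T)` through `T`. -/
theorem dim_ker_comp (T : V →ₗ[ℂ] V') (S : V' →ₗ[ℂ] V'') :
    dim (LinearMap.ker (S ∘ₗ T)) =
      dim (LinearMap.ker T) + dim (LinearMap.ker S ⊓ LinearMap.range T : Submodule ℂ V') := by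
  have h : LinearMap.ker T ≤ LinearMap.ker (S ∘ₗ T) := LinearMap.ker_le_ker_comp T S
  rw [← dim_ker_add_dim_range (T.domRestrict (LinearMap.ker (S ∘ₗ T))),
    LinearMap.ker_domRestrict, LinearMap.range_domRestrict,
    dim_congr (equivSubtypeMap _ ((LinearMap.ker T).comap (LinearMap.ker (S ∘ₗ T)).subtype)),
    map_comap_subtype, inf_eq_right.2 h, LinearMap.ker_comp, map_comap_eq, inf_comm]

/-- `R(S) / R(ST)` is isomorphic to `V' / (R(T) + N(S))` through `S`. -/
theorem dim_quotient_range_comp (T : V →ₗ[ℂ] V') (S : V' →ₗ[ℂ] V'') :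
    dim (V'' ⧸ LinearMap.range (S ∘ₗ T)) =
      dim (V' ⧸ (LinearMap.range T ⊔ LinearMap.ker S)) + dim (V'' ⧸ LinearMap.range S) := by
  have h : LinearMap.range (S ∘ₗ T) ≤ LinearMap.range S := LinearMap.range_comp_le_range T S
  rw [← dim_map_mkQ_add_dim_quotient_sup (LinearMap.range S), sup_eq_right.2 h,
    ← LinearMap.range_comp,
    ← dim_congr ((LinearMap.range (S ∘ₗ T)).mkQ ∘ₗ S).quotKerEquivRange, LinearMap.ker_comp,
    ker_mkQ, LinearMap.range_comp, comap_map_eq]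

/-- The index formula for a composition, in the subtraction-free form
`α(T) + α(S) + β(ST) = α(ST) + β(T) + β(S)`, which holds for infinite dimensions too. -/
theorem index_comp (T : V →ₗ[ℂ] V') (S : V' →ₗ[ℂ] V'') :
    dim (LinearMap.ker T) + dim (LinearMap.ker S) + dim (V'' ⧸ LinearMap.range (S ∘ₗ T)) =
      dim (LinearMap.ker (S ∘ₗ T)) + dim (V' ⧸ LinearMap.range T) +
        dim (V'' ⧸ LinearMap.range S) := by
  rw [dim_ker_comp, dim_quotient_range_comp,
    ← dim_inf_add_dim_map_mkQ (LinearMap.ker S) (LinearMap.range T),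
    ← dim_map_mkQ_add_dim_quotient_sup (LinearMap.ker S) (LinearMap.range T)]
  ring

theorem dim_ker_pow_lt_top (T : Module.End ℂ V) (h : dim (LinearMap.ker T) < ⊤) (n : ℕ) :
    dim (LinearMap.ker (T ^ n)) < ⊤ := by
  induction n with
  | zero =>
    rw [pow_zero, Module.End.one_eq_id, LinearMap.ker_id, dim_lt_top_iff]
    infer_instance
  | succ n ih =>
    rw [pow_succ, Module.End.mul_eq_comp, dim_ker_comp]
    exact ENat.add_lt_top.2 ⟨h, (dim_submodule_mono inf_le_left).trans_lt ih⟩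

theorem dim_quotient_range_pow_lt_top (T : Module.End ℂ V)
    (h : dim (V ⧸ LinearMap.range T) < ⊤) (n : ℕ) :
    dim (V ⧸ LinearMap.range (T ^ n)) < ⊤ := by
  induction n with
  | zero =>
    rw [pow_zero, Module.End.one_eq_id, LinearMap.range_id, dim_lt_top_iff]
    infer_instance
  | succ n ih =>
    rw [pow_succ, Module.End.mul_eq_comp, dim_quotient_range_comp]
    exact ENat.add_lt_top.2 ⟨(dim_quotient_anti le_sup_left).trans_lt h, ih⟩

/-! ### Ascent, descent and index -/

/-- Once the kernels of the powers stabilize at `T ^ n`, they stay equal. -/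
theorem ker_pow_stable {T : Module.End ℂ V} {n : ℕ}
    (h : LinearMap.ker (T ^ n) = LinearMap.ker (T ^ (n + 1))) {m : ℕ} (hm : n ≤ m) :
    LinearMap.ker (T ^ m) = LinearMap.ker (T ^ n) := by
  induction m, hm using Nat.le_induction with
  | base => rfl
  | succ m hm ih =>
    rw [pow_succ, Module.End.mul_eq_comp, LinearMap.ker_comp, ih, ← LinearMap.ker_comp,
      ← Module.End.mul_eq_comp, ← pow_succ, h]

/-- Once the ranges of the powers stabilize at `T ^ n`, they stay equal. -/
theorem range_pow_stable {T : Module.End ℂ V} {n : ℕ}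
    (h : LinearMap.range (T ^ n) = LinearMap.range (T ^ (n + 1))) {m : ℕ} (hm : n ≤ m) :
    LinearMap.range (T ^ m) = LinearMap.range (T ^ n) := by
  induction m, hm using Nat.le_induction with
  | base => rfl
  | succ m hm ih =>
    rw [pow_succ', Module.End.mul_eq_comp, LinearMap.range_comp, ih, ← LinearMap.range_comp,
      ← Module.End.mul_eq_comp, ← pow_succ', h]

/-- If both the kernels and the ranges of the powers of a Fredholm endomorphism stabilize, then
its index is zero. -/
theorem dim_ker_eq_dim_quotient_range {T : Module.End ℂ V} (hα : dim (LinearMap.ker T) < ⊤)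
    (hβ : dim (V ⧸ LinearMap.range T) < ⊤) {p q : ℕ}
    (hp : LinearMap.ker (T ^ p) = LinearMap.ker (T ^ (p + 1)))
    (hq : LinearMap.range (T ^ q) = LinearMap.range (T ^ (q + 1))) :
    dim (LinearMap.ker T) = dim (V ⧸ LinearMap.range T) := by
  have h := index_comp (T ^ max p q) T
  have hk : LinearMap.ker (T ∘ₗ T ^ max p q) = LinearMap.ker (T ^ max p q) := by
    rw [← Module.End.mul_eq_comp, ← pow_succ', ker_pow_stable hp (le_max_left p q),
      ker_pow_stable hp ((le_max_left p q).trans (Nat.le_succ _))]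
  have hr : LinearMap.range (T ∘ₗ T ^ max p q) = LinearMap.range (T ^ max p q) := by
    rw [← Module.End.mul_eq_comp, ← pow_succ', range_pow_stable hq (le_max_right p q),
      range_pow_stable hq ((le_max_right p q).trans (Nat.le_succ _))]
  rw [hk, hr] at h
  have h1 := dim_ker_pow_lt_top T hα (max p q)
  have h2 := dim_quotient_range_pow_lt_top T hβ (max p q)
  lift dim (LinearMap.ker T) to ℕ using hα.ne with a
  lift dim (V ⧸ LinearMap.range T) to ℕ using hβ.ne with b
  lift dim (LinearMap.ker (T ^ max p q)) to ℕ using h1.ne with c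
  lift dim (V ⧸ LinearMap.range (T ^ max p q)) to ℕ using h2.ne with d
  norm_cast at *
  omega

theorem dim_eq_zero_iff : dim V = 0 ↔ Subsingleton V := by
  rw [dim_eq_length, Module.length_eq_zero_iff]

theorem le_of_dim_map_mkQ_eq_zero {p q : Submodule ℂ V} (h : dim (q.map p.mkQ) = 0) : q ≤ p := by
  rw [dim_eq_zero_iff, Submodule.subsingleton_iff_eq_bot, ← le_bot_iff, map_le_iff_le_comap] at h
  simpa using h

theorem eq_of_le_of_dim_eq {p q : Submodule ℂ V} (h : p ≤ q) (hp : dim p < ⊤)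
    (hpq : dim p = dim q) : p = q := by
  have := dim_inf_add_dim_map_mkQ q p
  rw [inf_eq_right.2 h, ← hpq] at this
  exact h.antisymm (le_of_dim_map_mkQ_eq_zero (enat_add_left_cancel hp.ne
    (this.trans (add_zero _).symm)))

theorem eq_of_le_of_dim_quotient_eq {p q : Submodule ℂ V} (h : p ≤ q) (hp : dim (V ⧸ p) < ⊤)
    (hpq : dim (V ⧸ p) = dim (V ⧸ q)) : p = q := by
  have := dim_map_mkQ_add_dim_quotient_sup q p
  rw [sup_eq_right.2 h, ← hpq] at this
  exact h.antisymm (le_of_dim_map_mkQ_eq_zero (enat_add_right_cancel hp.ne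
    (this.trans (zero_add _).symm)))

/-- The powers of a Fredholm endomorphism of index zero have index zero. -/
theorem dim_ker_pow_eq_dim_quotient_range_pow {T : Module.End ℂ V}
    (hα : dim (LinearMap.ker T) < ⊤)
    (hβ : dim (LinearMap.ker T) = dim (V ⧸ LinearMap.range T)) (n : ℕ) :
    dim (LinearMap.ker (T ^ n)) = dim (V ⧸ LinearMap.range (T ^ n)) := by
  induction n with
  | zero =>
    have h1 : dim (LinearMap.ker (T ^ 0)) = 0 := by
      rw [pow_zero, Module.End.one_eq_id, LinearMap.ker_id, dim_eq_zero_iff]; infer_instance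
    have h2 : dim (V ⧸ LinearMap.range (T ^ 0)) = 0 := by
      rw [pow_zero, Module.End.one_eq_id, LinearMap.range_id, dim_eq_zero_iff]
      infer_instance
    rw [h1, h2]
  | succ n ih =>
    have h := index_comp T (T ^ n)
    rw [← Module.End.mul_eq_comp, ← pow_succ, ← hβ, ← ih, add_assoc, add_assoc,
      add_comm (dim (LinearMap.ker (T ^ (n + 1)))), add_assoc] at h
    have h1 := dim_ker_pow_lt_top T hα n
    exact (enat_add_left_cancel h1.ne (enat_add_left_cancel hα.ne h)).symm

/-- For a Fredholm endomorphism of index zero, the kernels of the powers stabilize exactly where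
the ranges do, since `dim N(T ^ n) = codim R(T ^ n)` for every `n`. -/
theorem ker_pow_eq_iff_range_pow_eq {T : Module.End ℂ V} (hα : dim (LinearMap.ker T) < ⊤)
    (hβ : dim (LinearMap.ker T) = dim (V ⧸ LinearMap.range T)) (n : ℕ) :
    LinearMap.ker (T ^ n) = LinearMap.ker (T ^ (n + 1)) ↔
      LinearMap.range (T ^ n) = LinearMap.range (T ^ (n + 1)) := by
  have h := dim_ker_pow_eq_dim_quotient_range_pow hα hβ
  constructor
  · intro hn
    refine (eq_of_le_of_dim_quotient_eq ?_ ?_ ?_).symm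
    · rw [pow_succ, Module.End.mul_eq_comp]
      exact LinearMap.range_comp_le_range _ _
    · rw [← h]
      exact dim_ker_pow_lt_top T hα _
    · rw [← h, ← h, hn]
  · intro hn
    refine eq_of_le_of_dim_eq ?_ (dim_ker_pow_lt_top T hα _) ?_
    · rw [pow_succ', Module.End.mul_eq_comp]
      exact LinearMap.ker_le_ker_comp _ _
    · rw [h, h, hn]

/-- If `N = N(T ^ p)` is the stable kernel of a `T` with finite nullity, then passing from `R(T)`
to `R(T) + N` lowers the codimension by exactly `α(T)`. -/
theorem dim_ker_add_dim_quotient_sup {T : Module.End ℂ V} (hα : dim (LinearMap.ker T) < ⊤) {p : ℕ}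
    (hp : LinearMap.ker (T ^ p) = LinearMap.ker (T ^ (p + 1))) :
    dim (LinearMap.ker T) + dim (V ⧸ (LinearMap.range T ⊔ LinearMap.ker (T ^ p))) =
      dim (V ⧸ LinearMap.range T) := by
  have hN := dim_ker_pow_lt_top T hα p
  -- Stability gives `N(T) ≤ N` and `T(N) = N ∩ R(T)`, so rank-nullity for `T` restricted to `N`
  -- computes the dimension of `N / (N ∩ R(T))`.
  have h1 : dim (LinearMap.ker (T ^ p)) = dim (LinearMap.ker T) +
      dim (LinearMap.ker (T ^ p) ⊓ LinearMap.range T : Submodule ℂ V) := by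
    conv_lhs => rw [hp, pow_succ, Module.End.mul_eq_comp, dim_ker_comp]
  have h2 := dim_inf_add_dim_map_mkQ (LinearMap.ker (T ^ p)) (LinearMap.range T)
  have h3 := (dim_submodule_mono (inf_le_left :
    LinearMap.ker (T ^ p) ⊓ LinearMap.range T ≤ LinearMap.ker (T ^ p))).trans_lt hN
  rw [h1, add_comm] at h2
  rw [← dim_map_mkQ_add_dim_quotient_sup (LinearMap.ker (T ^ p)) (LinearMap.range T),
    enat_add_right_cancel h3.ne h2]

/-- If `L = R(T ^ q)` is the stable range of a `T` with finite deficiency, then passing from `N(T)`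
to `N(T) ∩ L` lowers the dimension by exactly `β(T)`. -/
theorem dim_ker_inf_add_dim_quotient {T : Module.End ℂ V} (hβ : dim (V ⧸ LinearMap.range T) < ⊤)
    {q : ℕ} (hq : LinearMap.range (T ^ q) = LinearMap.range (T ^ (q + 1))) :
    dim (LinearMap.ker T ⊓ LinearMap.range (T ^ q) : Submodule ℂ V) +
      dim (V ⧸ LinearMap.range T) = dim (LinearMap.ker T) := by
  have hL := dim_quotient_range_pow_lt_top T hβ q
  have h1 : dim (V ⧸ LinearMap.range (T ^ q)) =
      dim (V ⧸ (LinearMap.range (T ^ q) ⊔ LinearMap.ker T)) + dim (V ⧸ LinearMap.range T) := by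
    conv_lhs => rw [hq, pow_succ', Module.End.mul_eq_comp, dim_quotient_range_comp]
  have h2 := dim_map_mkQ_add_dim_quotient_sup (LinearMap.ker T) (LinearMap.range (T ^ q))
  have h3 := (dim_quotient_anti (le_sup_left :
    LinearMap.range (T ^ q) ≤ LinearMap.range (T ^ q) ⊔ LinearMap.ker T)).trans_lt hL
  rw [h1, add_comm] at h2
  rw [← dim_inf_add_dim_map_mkQ (LinearMap.ker T) (LinearMap.range (T ^ q)),
    enat_add_left_cancel h3.ne h2]

/-! ### Endomorphisms that are bijective up to finite-dimensional nilpotent parts -/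

section Filtration
variable {T : Module.End ℂ V} {X₁ X₂ : Submodule ℂ V}

/-- If `T` is injective on `X₂` modulo `X₁`, so is every power of `T`. -/
theorem mem_of_pow_mem (h : ∀ v ∈ X₂, T v ∈ X₂)
    (hker : ∀ v ∈ X₂, T v ∈ X₁ → v ∈ X₁) (n : ℕ) {v : V} (hv : v ∈ X₂)
    (hn : (T ^ n) v ∈ X₁) : v ∈ X₁ := by
  induction n generalizing v with
  | zero => simpa using hn
  | succ n ih =>
    rw [pow_succ, Module.End.mul_apply] at hn
    exact hker v hv (ih (h v hv) hn)

/-- If `T` maps `X₂` onto `X₂` modulo the invariant subspace `X₁`, so does every power of `T`. -/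
theorem le_map_pow_sup (h : ∀ v ∈ X₁, T v ∈ X₁) (hrange : X₂ ≤ X₂.map T ⊔ X₁) (n : ℕ) :
    X₂ ≤ X₂.map (T ^ n) ⊔ X₁ := by
  induction n with
  | zero => simp [Module.End.one_eq_id]
  | succ n ih =>
    refine hrange.trans (sup_le ((Submodule.map_mono ih).trans ?_) le_sup_right)
    rw [Submodule.map_sup, ← Submodule.map_comp, ← Module.End.mul_eq_comp, ← pow_succ']
    exact sup_le_sup_left (map_le_iff_le_comap.2 h) _

/-- Suppose `X₁` and `X₂` are `T`-invariant subspaces with `T` nilpotent on the finite-dimensional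
`X₁` and on the finite-dimensional `V ⧸ X₂`. If `T` is injective and surjective from `X₂` to `X₂`
modulo `X₁`, then `T` is Fredholm and the kernels and ranges of its powers stabilize. -/
theorem fredholm_and_stable_of_filtration (h₁ : ∀ v ∈ X₁, T v ∈ X₁) (h₂ : ∀ v ∈ X₂, T v ∈ X₂)
    {p q : ℕ} (hp : ∀ v ∈ X₁, (T ^ p) v = 0) (hq : ∀ v, (T ^ q) v ∈ X₂) (hd₁ : dim X₁ < ⊤)
    (hd₂ : dim (V ⧸ X₂) < ⊤) (hker : ∀ v ∈ X₂, T v ∈ X₁ → v ∈ X₁) (hrange : X₂ ≤ X₂.map T ⊔ X₁) :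
    dim (LinearMap.ker T) < ⊤ ∧ dim (V ⧸ LinearMap.range T) < ⊤ ∧
      LinearMap.ker (T ^ (p + q)) = LinearMap.ker (T ^ (p + q + 1)) ∧
      LinearMap.range (T ^ (p + q)) = LinearMap.range (T ^ (p + q + 1)) := by
  refine ⟨?_, ?_, le_antisymm ?_ ?_, le_antisymm ?_ ?_⟩
  · rw [← dim_inf_add_dim_map_mkQ _ X₂]
    refine ENat.add_lt_top.2 ⟨(dim_submodule_mono ?_).trans_lt hd₁,
      (dim_le_of_injective _ (subtype_injective _)).trans_lt hd₂⟩
    rintro v ⟨hv, hv₂⟩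
    exact hker v hv₂ (by rw [LinearMap.mem_ker.1 hv]; exact X₁.zero_mem)
  · rw [← dim_map_mkQ_add_dim_quotient_sup X₁]
    refine ENat.add_lt_top.2 ⟨?_, (dim_quotient_anti ?_).trans_lt hd₂⟩
    · refine (dim_le_of_surjective _
        ((LinearMap.range T).mkQ.submoduleMap_surjective X₁)).trans_lt hd₁
    · exact hrange.trans (sup_le_sup_right LinearMap.map_le_range _)
  · rw [pow_succ', Module.End.mul_eq_comp]
    exact LinearMap.ker_le_ker_comp _ _
  · intro v hv
    rw [LinearMap.mem_ker, add_right_comm, pow_add, Module.End.mul_apply] at hv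
    rw [LinearMap.mem_ker, pow_add, Module.End.mul_apply]
    exact hp _ (mem_of_pow_mem h₂ hker (p + 1) (hq v) (by rw [hv]; exact X₁.zero_mem))
  · rintro _ ⟨v, rfl⟩
    obtain ⟨_, ⟨u, -, rfl⟩, n, hn, huv⟩ :=
      mem_sup.1 (le_map_pow_sup h₁ hrange (q + 1) (hq v))
    refine ⟨u, ?_⟩
    rw [add_assoc, pow_add, pow_add T p q, Module.End.mul_apply, Module.End.mul_apply, ← huv,
      map_add, hp n hn, add_zero]
  · rw [pow_succ, Module.End.mul_eq_comp]
    exact LinearMap.range_comp_le_range _ _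

end Filtration
end Dim

/-! ### Closed ranges -/

section Hilbert

theorem closedComplemented_of_isClosed {E : Type*} [NormedAddCommGroup E] [InnerProductSpace ℂ E]
    [CompleteSpace E] {p : Submodule ℂ E} (hp : IsClosed (p : Set E)) : p.ClosedComplemented := by
  have := hp.completeSpace_coe
  exact ClosedComplemented.of_isCompl_isClosed p.isCompl_orthogonal hp p.isClosed_orthogonal

/-- If `R(T)` has finite codimension, then `T` maps a closed subspace `Z` to a closed subspace as
soon as `Z + N(T)` is closed. Adding a finite-dimensional complement `G` of `R(T)` to the domain
gives a surjection `(x, g) ↦ T x + g`, which is a quotient map by the open mapping theorem; the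
preimage of `T(Z)` under it is `(Z + N(T)) × 0`. -/
theorem isClosed_map_of_dim_quotient_range_lt_top {E F : Type*} [NormedAddCommGroup E]
    [NormedSpace ℂ E] [CompleteSpace E] [NormedAddCommGroup F] [NormedSpace ℂ F] [CompleteSpace F]
    (T : E →L[ℂ] F) (hβ : dim (F ⧸ LinearMap.range (T : E →ₗ[ℂ] F)) < ⊤) (Z : Submodule ℂ E)
    (hZ : IsClosed ((Z ⊔ LinearMap.ker (T : E →ₗ[ℂ] F) : Submodule ℂ E) : Set E)) :
    IsClosed (Z.map (T : E →ₗ[ℂ] F) : Set F) := by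
  obtain ⟨G, hG⟩ := (LinearMap.range (T : E →ₗ[ℂ] F)).exists_isCompl
  have : FiniteDimensional ℂ G :=
    dim_lt_top_iff.1 ((dim_congr (quotientEquivOfIsCompl _ G hG)).symm.trans_lt hβ)
  set S : E × G →L[ℂ] F := T.coprod G.subtypeL with hS
  have hsurj : Function.Surjective S := by
    intro y
    obtain ⟨_, ⟨x, rfl⟩, g, hg, rfl⟩ := mem_sup.1 (hG.sup_eq_top.ge (mem_top : y ∈ ⊤))
    exact ⟨(x, ⟨g, hg⟩), by simp [hS]⟩
  rw [← (S.isQuotientMap hsurj).isClosed_preimage]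
  suffices h : S ⁻¹' (Z.map (T : E →ₗ[ℂ] F) : Set F) =
      ((Z ⊔ LinearMap.ker (T : E →ₗ[ℂ] F) : Submodule ℂ E) : Set E) ×ˢ {(0 : G)} by
    rw [h]
    exact hZ.prod isClosed_singleton
  refine Set.ext fun ⟨x, g⟩ => ?_
  simp only [Set.mem_preimage, Set.mem_prod, SetLike.mem_coe, Set.mem_singleton_iff]
  rw [← comap_map_eq, mem_comap]
  constructor
  · rintro ⟨z, hz, hzx⟩
    have hg : (g : F) = 0 := by
      refine disjoint_def.1 hG.disjoint _ ⟨z - x, ?_⟩ g.2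
      rw [map_sub, hzx]
      simp [hS]
    refine ⟨⟨z, hz, ?_⟩, by simpa using hg⟩
    simpa [hS, hg] using hzx
  · rintro ⟨⟨z, hz, hzx⟩, rfl⟩
    exact ⟨z, hz, by simpa [hS] using hzx⟩

theorem isClosed_range_of_dim_quotient_lt_top {E F : Type*} [NormedAddCommGroup E]
    [NormedSpace ℂ E] [CompleteSpace E] [NormedAddCommGroup F] [NormedSpace ℂ F] [CompleteSpace F]
    (T : E →L[ℂ] F) (hβ : dim (F ⧸ LinearMap.range (T : E →ₗ[ℂ] F)) < ⊤) :
    IsClosed (LinearMap.range (T : E →ₗ[ℂ] F) : Set F) := by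
  rw [← Submodule.map_top]
  exact isClosed_map_of_dim_quotient_range_lt_top T hβ ⊤ (by simp)

/-! ### Isomorphisms of separable Hilbert spaces -/

/-- The balls of radius `1 / 2` around the vectors of an orthonormal family are disjoint. -/
theorem countable_of_orthonormal {E ι : Type*} [NormedAddCommGroup E] [InnerProductSpace ℂ E]
    [TopologicalSpace.SeparableSpace E] {v : ι → E} (hv : Orthonormal ℂ v) : Countable ι := by
  refine Pairwise.countable_of_isOpen_disjoint (s := fun i => Metric.ball (v i) (1 / 2)) ?_
    (fun _ => Metric.isOpen_ball) (fun _ => ⟨_, Metric.mem_ball_self (by norm_num)⟩)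
  intro i j hij
  refine Metric.ball_disjoint_ball ?_
  have h := norm_sub_sq (𝕜 := ℂ) (v i) (v j)
  rw [hv.2 hij, hv.1, hv.1] at h
  rw [dist_eq_norm]
  simp only [map_zero] at h
  nlinarith [norm_nonneg (v i - v j)]

theorem nonempty_hilbertBasis_nat (E : Type*) [NormedAddCommGroup E] [InnerProductSpace ℂ E]
    [CompleteSpace E] [TopologicalSpace.SeparableSpace E] (hE : ¬ FiniteDimensional ℂ E) :
    Nonempty (HilbertBasis ℕ ℂ E) := by
  obtain ⟨w, b, -⟩ := exists_hilbertBasis ℂ E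
  have := countable_of_orthonormal b.orthonormal
  have : Infinite w := by
    by_contra h
    rw [not_infinite_iff_finite] at h
    have := Fintype.ofFinite w
    exact hE b.toOrthonormalBasis.toBasis.finiteDimensional_of_finite
  obtain ⟨e⟩ := nonempty_equiv_of_countable (α := ℕ) (β := w)
  refine ⟨HilbertBasis.mk (b.orthonormal.comp e e.injective) ?_⟩
  rw [e.surjective.range_comp, b.dense_span]

theorem nonempty_continuousLinearEquiv_of_dim_eq {E F : Type*}
    [NormedAddCommGroup E] [InnerProductSpace ℂ E] [CompleteSpace E]
    [TopologicalSpace.SeparableSpace E] [NormedAddCommGroup F] [InnerProductSpace ℂ F]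
    [CompleteSpace F] [TopologicalSpace.SeparableSpace F] (h : dim E = dim F) :
    Nonempty (E ≃L[ℂ] F) := by
  by_cases hE : FiniteDimensional ℂ E
  · have hF : FiniteDimensional ℂ F := by
      rwa [← dim_lt_top_iff, ← h, dim_lt_top_iff]
    refine ⟨ContinuousLinearEquiv.ofFinrankEq ?_⟩
    rw [dim_eq_length, dim_eq_length, Module.length_eq_finrank, Module.length_eq_finrank] at h
    exact_mod_cast h
  · have hF : ¬ FiniteDimensional ℂ F := by
      rwa [← dim_lt_top_iff, ← h, dim_lt_top_iff]
    obtain ⟨b⟩ := nonempty_hilbertBasis_nat E hE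
    obtain ⟨c⟩ := nonempty_hilbertBasis_nat F hF
    exact ⟨(b.repr.trans c.repr.symm).toContinuousLinearEquiv⟩

/-- An isomorphism of separable Hilbert spaces that carries a given closed subspace onto another
exists if the subspaces have the same dimension and so do their orthogonal complements. -/
theorem exists_continuousLinearEquiv_mem_iff {E F : Type*}
    [NormedAddCommGroup E] [InnerProductSpace ℂ E] [CompleteSpace E]
    [TopologicalSpace.SeparableSpace E] [NormedAddCommGroup F] [InnerProductSpace ℂ F]
    [CompleteSpace F] [TopologicalSpace.SeparableSpace F] {U : Submodule ℂ E}
    {W : Submodule ℂ F} (hU : IsClosed (U : Set E)) (hW : IsClosed (W : Set F))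
    (h : dim U = dim W) (h' : dim Uᗮ = dim Wᗮ) :
    ∃ C : E ≃L[ℂ] F, ∀ x, C x ∈ W ↔ x ∈ U := by
  have := hU.completeSpace_coe
  have := hW.completeSpace_coe
  obtain ⟨e⟩ := nonempty_continuousLinearEquiv_of_dim_eq h
  obtain ⟨e'⟩ := nonempty_continuousLinearEquiv_of_dim_eq h'
  let P := U.orthogonalDecomposition.toContinuousLinearEquiv.trans
    (WithLp.prodContinuousLinearEquiv 2 ℂ U Uᗮ)
  let Q := W.orthogonalDecomposition.toContinuousLinearEquiv.trans
    (WithLp.prodContinuousLinearEquiv 2 ℂ W Wᗮ)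
  have hP : ∀ x, (P x).2 = 0 ↔ x ∈ U := by
    intro x
    simp [P]
  have hQ : ∀ x, (Q x).2 = 0 ↔ x ∈ W := by
    intro x
    simp [Q]
  refine ⟨P.trans ((e.prodCongr e').trans Q.symm), fun x => ?_⟩
  rw [← hP, ← hQ]
  simp

end Hilbert

/-! ### Operators of finite ascent and descent -/

section AscentDescent
variable {X : Type*} [NormedAddCommGroup X] [NormedSpace ℂ X]

theorem ascent_lt_top_iff {T : X →L[ℂ] X} : ascent T < ⊤ ↔
    ∃ n : ℕ, LinearMap.ker ((T : X →ₗ[ℂ] X) ^ n) = LinearMap.ker ((T : X →ₗ[ℂ] X) ^ (n + 1)) := by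
  simp [ascent, iInf_lt_iff, ContinuousLinearMap.toLinearMap_pow]

theorem descent_lt_top_iff {T : X →L[ℂ] X} : descent T < ⊤ ↔
    ∃ n : ℕ, LinearMap.range ((T : X →ₗ[ℂ] X) ^ n) =
      LinearMap.range ((T : X →ₗ[ℂ] X) ^ (n + 1)) := by
  simp [descent, iInf_lt_iff, ContinuousLinearMap.toLinearMap_pow]

/-- A Fredholm operator with finite ascent and finite descent is Browder: its index is zero, hence
its ascent and descent agree. -/
theorem isBrowder_of_lt_top {T : X →L[ℂ] X} (hT : IsFredholm T) (ha : ascent T < ⊤)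
    (hd : descent T < ⊤) : IsBrowder T := by
  refine ⟨hT, ?_, ha⟩
  obtain ⟨p, hp⟩ := ascent_lt_top_iff.1 ha
  obtain ⟨q, hq⟩ := descent_lt_top_iff.1 hd
  have h := ker_pow_eq_iff_range_pow_eq hT.1 (dim_ker_eq_dim_quotient_range hT.1 hT.2 hp hq)
  simp only [ascent, descent, ContinuousLinearMap.toLinearMap_pow, h]

/-- The criterion `fredholm_and_stable_of_filtration` for operators. -/
theorem isBrowder_of_filtration {T : X →L[ℂ] X} {X₁ X₂ : Submodule ℂ X}
    (h₁ : ∀ v ∈ X₁, T v ∈ X₁) (h₂ : ∀ v ∈ X₂, T v ∈ X₂) {p q : ℕ}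
    (hp : ∀ v ∈ X₁, ((T : X →ₗ[ℂ] X) ^ p) v = 0) (hq : ∀ v, ((T : X →ₗ[ℂ] X) ^ q) v ∈ X₂)
    (hd₁ : dim X₁ < ⊤) (hd₂ : dim (X ⧸ X₂) < ⊤) (hker : ∀ v ∈ X₂, T v ∈ X₁ → v ∈ X₁)
    (hrange : X₂ ≤ X₂.map (T : X →ₗ[ℂ] X) ⊔ X₁) : IsBrowder T := by
  obtain ⟨h1, h2, h3, h4⟩ := fredholm_and_stable_of_filtration (T := (T : X →ₗ[ℂ] X))
    h₁ h₂ hp hq hd₁ hd₂ hker hrange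
  exact isBrowder_of_lt_top ⟨h1, h2⟩ (ascent_lt_top_iff.2 ⟨_, h3⟩) (descent_lt_top_iff.2 ⟨_, h4⟩)

theorem IsBrowder.nullity_eq_deficiency {T : X →L[ℂ] X} (hT : IsBrowder T) :
    nullity T = deficiency T := by
  obtain ⟨p, hp⟩ := ascent_lt_top_iff.1 hT.2.2
  obtain ⟨q, hq⟩ := descent_lt_top_iff.1 (hT.2.1 ▸ hT.2.2)
  exact dim_ker_eq_dim_quotient_range hT.1.1 hT.1.2 hp hq

theorem isFredholm_of_isInvertible {Y : Type*} [NormedAddCommGroup Y] [NormedSpace ℂ Y]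
    {T : X →L[ℂ] Y} (hT : T.IsInvertible) : IsFredholm T := by
  obtain ⟨e, rfl⟩ := hT
  have hk : LinearMap.ker ((e : X →L[ℂ] Y) : X →ₗ[ℂ] Y) = ⊥ := e.toLinearEquiv.ker
  have hr : LinearMap.range ((e : X →L[ℂ] Y) : X →ₗ[ℂ] Y) = ⊤ := e.toLinearEquiv.range
  rw [IsFredholm, nullity, deficiency, hk, hr, dim_lt_top_iff, dim_lt_top_iff]
  exact ⟨inferInstance, inferInstance⟩

end AscentDescent

/-! ### Structure of upper triangular operator matrices -/

section UpperTriangular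
variable {H K : Type*} [NormedAddCommGroup H] [InnerProductSpace ℂ H]
  [NormedAddCommGroup K] [InnerProductSpace ℂ K]

/-- The inclusion `x ↦ (x, 0)` of the first summand of `H ⊕ K`. -/
noncomputable def inclFst (H K : Type*) [NormedAddCommGroup H] [InnerProductSpace ℂ H]
    [NormedAddCommGroup K] [InnerProductSpace ℂ K] : H →L[ℂ] WithLp 2 (H × K) :=
  ((WithLp.prodContinuousLinearEquiv 2 ℂ H K).symm : H × K →L[ℂ] WithLp 2 (H × K)) ∘L
    ContinuousLinearMap.inl ℂ H K

/-- The projection `(x, y) ↦ y` of `H ⊕ K` onto the second summand. -/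
noncomputable def projSnd (H K : Type*) [NormedAddCommGroup H] [InnerProductSpace ℂ H]
    [NormedAddCommGroup K] [InnerProductSpace ℂ K] : WithLp 2 (H × K) →L[ℂ] K :=
  ContinuousLinearMap.snd ℂ H K ∘L
    ((WithLp.prodContinuousLinearEquiv 2 ℂ H K) : WithLp 2 (H × K) →L[ℂ] H × K)

@[simp]
theorem inclFst_apply (x : H) : inclFst H K x = WithLp.toLp 2 (x, 0) := rfl

theorem inclFst_injective : Function.Injective (inclFst H K) := fun x y h => by
  simpa using h

theorem projSnd_surjective : Function.Surjective (projSnd H K) :=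
  fun y => ⟨WithLp.toLp 2 (0, y), rfl⟩

theorem exists_eq_toLp {H K : Type*} (v : WithLp 2 (H × K)) : ∃ x y, v = WithLp.toLp 2 (x, y) :=
  ⟨v.fst, v.snd, rfl⟩

variable (A : H →L[ℂ] H) (B : K →L[ℂ] K) (C : K →L[ℂ] H)

theorem shift_upperTriangular (l : ℂ) :
    shift (upperTriangular A B C) l = upperTriangular (shift A l) (shift B l) C := by
  ext v
  obtain ⟨x, y, rfl⟩ := exists_eq_toLp v
  simp only [shift, _root_.sub_apply, _root_.smul_apply,
    ContinuousLinearMap.id_apply, upperTriangular_apply, ← WithLp.toLp_smul, ← WithLp.toLp_sub,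
    Prod.smul_mk, Prod.mk_sub_mk]
  congr 2
  abel

theorem upperTriangular_pow_inclFst (n : ℕ) (x : H) :
    ((upperTriangular A B C : WithLp 2 (H × K) →ₗ[ℂ] WithLp 2 (H × K)) ^ n) (inclFst H K x) =
      inclFst H K (((A : H →ₗ[ℂ] H) ^ n) x) := by
  induction n generalizing x with
  | zero => rfl
  | succ n ih =>
    rw [pow_succ, pow_succ, Module.End.mul_apply, Module.End.mul_apply, ← ih]
    simp [upperTriangular_apply]

theorem projSnd_upperTriangular_pow (n : ℕ) (v : WithLp 2 (H × K)) :
    projSnd H K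
        (((upperTriangular A B C : WithLp 2 (H × K) →ₗ[ℂ] WithLp 2 (H × K)) ^ n) v) =
      ((B : K →ₗ[ℂ] K) ^ n) (projSnd H K v) := by
  induction n generalizing v with
  | zero => rfl
  | succ n ih =>
    rw [pow_succ, pow_succ, Module.End.mul_apply, Module.End.mul_apply, ih]
    rfl

/-- The index formula for an operator matrix, in subtraction-free form. It is the index formula for
the factorization of `M_C` into `diag(A, I)` followed by `[I C; 0 B]`, whose nullities and
deficiencies are those of `A` and of `B`. -/
theorem index_upperTriangular :
    nullity A + nullity B + deficiency (upperTriangular A B C) =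
      nullity (upperTriangular A B C) + deficiency A + deficiency B := by
  let e := WithLp.linearEquiv 2 ℂ (H × K)
  let T : WithLp 2 (H × K) →ₗ[ℂ] H × K := (A : H →ₗ[ℂ] H).prodMap LinearMap.id ∘ₗ e
  let S : H × K →ₗ[ℂ] WithLp 2 (H × K) :=
    e.symm ∘ₗ ((LinearMap.id.coprod (C : K →ₗ[ℂ] H)).prod
      ((B : K →ₗ[ℂ] K) ∘ₗ LinearMap.snd ℂ H K))
  have hST : S ∘ₗ T = upperTriangular A B C := rfl
  have hαT : nullity A = dim (LinearMap.ker T) := by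
    have h : (LinearMap.ker (A : H →ₗ[ℂ] H)).map (inclFst H K : H →ₗ[ℂ] WithLp 2 (H × K)) =
        LinearMap.ker T := by
      refine Submodule.ext fun v => ⟨?_, fun hv => ?_⟩
      · rintro ⟨x, hx, rfl⟩
        exact Prod.ext hx rfl
      · obtain ⟨h1, h2⟩ := Prod.mk_inj.1 (show (A v.fst, v.snd) = (0, 0) from hv)
        exact ⟨v.fst, h1, congrArg (WithLp.toLp 2) (Prod.ext rfl h2.symm)⟩
    rw [← h, nullity, dim_congr (equivMapOfInjective (inclFst H K : H →ₗ[ℂ] WithLp 2 (H × K))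
      inclFst_injective (LinearMap.ker (A : H →ₗ[ℂ] H)))]
  have hβT : deficiency A = dim ((H × K) ⧸ LinearMap.range T) := by
    have h : (LinearMap.range (A : H →ₗ[ℂ] H)).comap (LinearMap.fst ℂ H K) =
        LinearMap.range T := by
      refine Submodule.ext fun ⟨x, y⟩ => ⟨?_, ?_⟩
      · rintro ⟨z, hz⟩
        exact ⟨WithLp.toLp 2 (z, y), Prod.ext hz rfl⟩
      · rintro ⟨v, hv⟩
        exact ⟨v.fst, congrArg Prod.fst hv⟩
    rw [← h, deficiency, dim_quotient_comap _ _ LinearMap.fst_surjective]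
  have hαS : nullity B = dim (LinearMap.ker S) := by
    let j : K →ₗ[ℂ] H × K := (-(C : K →ₗ[ℂ] H)).prod LinearMap.id
    have hj : Function.Injective j := fun x y h => congrArg Prod.snd h
    have h : (LinearMap.ker (B : K →ₗ[ℂ] K)).map j = LinearMap.ker S := by
      refine Submodule.ext fun ⟨x, y⟩ => ⟨?_, fun hv => ?_⟩
      · rintro ⟨z, hz, h⟩
        obtain ⟨rfl, rfl⟩ := Prod.mk_inj.1 (show (-C z, z) = (x, y) from h)
        exact congrArg (WithLp.toLp 2)
          (show (-C z + C z, B z) = ((0, 0) : H × K) by rw [neg_add_cancel]; exact congrArg _ hz)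
      · obtain ⟨h1, h2⟩ := Prod.mk_inj.1
          (show (x + C y, B y) = (0, 0) from congrArg WithLp.ofLp hv)
        exact ⟨y, h2, Prod.ext (eq_neg_of_add_eq_zero_left h1).symm rfl⟩
    rw [← h, nullity, dim_congr (equivMapOfInjective j hj (LinearMap.ker (B : K →ₗ[ℂ] K)))]
  have hβS : deficiency B = dim (WithLp 2 (H × K) ⧸ LinearMap.range S) := by
    have h : (LinearMap.range (B : K →ₗ[ℂ] K)).comap
        (projSnd H K : WithLp 2 (H × K) →ₗ[ℂ] K) = LinearMap.range S := by
      refine Submodule.ext fun v => ⟨?_, ?_⟩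
      · rintro ⟨z, hz⟩
        exact ⟨(v.fst - C z, z),
          congrArg (WithLp.toLp 2) (Prod.ext (sub_add_cancel v.fst (C z)) hz)⟩
      · rintro ⟨⟨x, y⟩, rfl⟩
        exact ⟨y, rfl⟩
    rw [← h, deficiency, dim_quotient_comap _ _ projSnd_surjective]
  rw [hαT, hβT, hαS, hβS, nullity, deficiency, ← hST]
  exact index_comp T S

variable {A B C}

theorem nullity_le_of_upperTriangular : nullity A ≤ nullity (upperTriangular A B C) := by
  rw [nullity, dim_congr (equivMapOfInjective (inclFst H K : H →ₗ[ℂ] WithLp 2 (H × K))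
    inclFst_injective (LinearMap.ker (A : H →ₗ[ℂ] H)))]
  refine dim_submodule_mono ?_
  rintro _ ⟨x, hx, rfl⟩
  have h := upperTriangular_pow_inclFst A B C 1 x
  rw [pow_one, pow_one, LinearMap.mem_ker.1 hx, map_zero] at h
  exact h

theorem deficiency_le_of_upperTriangular : deficiency B ≤ deficiency (upperTriangular A B C) := by
  refine dim_le_of_surjective (mapQ _ _ (projSnd H K : WithLp 2 (H × K) →ₗ[ℂ] K) ?_) ?_
  · rintro _ ⟨v, rfl⟩
    exact ⟨projSnd H K v, rfl⟩
  · rw [← LinearMap.range_eq_top, range_mapQ, LinearMap.range_eq_top.2 projSnd_surjective,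
      Submodule.map_top, range_mkQ]

/-! ### Browder operator matrices -/

/-- If `M_C` is Browder, then `A` is left semi-Browder, `B` is right semi-Browder and the nullities
and deficiencies balance. -/
theorem IsBrowder.of_upperTriangular [CompleteSpace H] [CompleteSpace K]
    (h : IsBrowder (upperTriangular A B C)) :
    IsLeftSemiBrowder A ∧ IsRightSemiBrowder B ∧
      nullity A + nullity B = deficiency A + deficiency B := by
  have hindex := h.nullity_eq_deficiency
  obtain ⟨⟨hα, hβ⟩, had, ha⟩ := h
  -- `R(A) ⊕ 0` is the image under `M_C` of the closed subspace `H ⊕ 0`.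
  have hclosed : IsClosed (LinearMap.range (A : H →ₗ[ℂ] H) : Set H) := by
    have : FiniteDimensional ℂ (LinearMap.ker
        (upperTriangular A B C : WithLp 2 (H × K) →ₗ[ℂ] WithLp 2 (H × K))) := dim_lt_top_iff.1 hα
    have hZ := isClosed_map_of_dim_quotient_range_lt_top (upperTriangular A B C) hβ
      (LinearMap.ker (projSnd H K : WithLp 2 (H × K) →ₗ[ℂ] K))
      (isClosed_sup_finiteDimensional _ _ (projSnd H K).isClosed_ker)
    convert hZ.preimage (inclFst H K).continuous using 1
    refine Set.ext fun x => ⟨?_, ?_⟩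
    · rintro ⟨z, rfl⟩
      refine ⟨inclFst H K z, rfl, ?_⟩
      simpa using upperTriangular_pow_inclFst A B C 1 z
    · rintro ⟨v, hv, hvx⟩
      obtain ⟨z, y, rfl⟩ := exists_eq_toLp v
      obtain rfl : y = 0 := hv
      refine ⟨z, inclFst_injective (K := K) (Eq.trans ?_ hvx)⟩
      simpa using (upperTriangular_pow_inclFst A B C 1 z).symm
  refine ⟨⟨⟨hclosed, closedComplemented_of_isClosed hclosed,
    nullity_le_of_upperTriangular.trans_lt hα⟩, ?_⟩,
    ⟨⟨B.isClosed_ker, closedComplemented_of_isClosed B.isClosed_ker,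
    deficiency_le_of_upperTriangular.trans_lt hβ⟩, ?_⟩, ?_⟩
  · obtain ⟨n, hn⟩ := ascent_lt_top_iff.1 ha
    refine ascent_lt_top_iff.2 ⟨n, Submodule.ext fun x => ?_⟩
    have := SetLike.ext_iff.1 hn (inclFst H K x)
    simpa only [LinearMap.mem_ker, upperTriangular_pow_inclFst,
      map_eq_zero_iff _ (inclFst_injective (H := H) (K := K))] using this
  · obtain ⟨n, hn⟩ := descent_lt_top_iff.1 (had ▸ ha)
    have key : ∀ m, LinearMap.range ((B : K →ₗ[ℂ] K) ^ m) = (LinearMap.range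
        ((upperTriangular A B C : WithLp 2 (H × K) →ₗ[ℂ] WithLp 2 (H × K)) ^ m)).map
          (projSnd H K : WithLp 2 (H × K) →ₗ[ℂ] K) := by
      intro m
      refine Submodule.ext fun y => ⟨?_, ?_⟩
      · rintro ⟨z, rfl⟩
        exact ⟨_, ⟨WithLp.toLp 2 (0, z), rfl⟩, projSnd_upperTriangular_pow A B C m _⟩
      · rintro ⟨_, ⟨v, rfl⟩, rfl⟩
        exact ⟨projSnd H K v, (projSnd_upperTriangular_pow A B C m v).symm⟩
    exact descent_lt_top_iff.2 ⟨n, by rw [key, key, hn]⟩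
  · have hi := index_upperTriangular A B C
    rw [hindex, add_comm, add_assoc] at hi
    exact enat_add_left_cancel hβ.ne hi

/-- `M_C` is Browder as soon as `C` maps `N(B) ∩ R(B ^ q)` isomorphically onto a complement of
`R(A) + N(A ^ p)`, where `N(A ^ p)` and `R(B ^ q)` are the stable kernel and range. Indeed `M_C` is
nilpotent on `N(A ^ p) ⊕ 0` and on the quotient by `H ⊕ R(B ^ q)`, and bijective in between. -/
theorem isBrowder_upperTriangular {p q : ℕ}
    (hp : LinearMap.ker ((A : H →ₗ[ℂ] H) ^ p) = LinearMap.ker ((A : H →ₗ[ℂ] H) ^ (p + 1)))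
    (hq : LinearMap.range ((B : K →ₗ[ℂ] K) ^ q) = LinearMap.range ((B : K →ₗ[ℂ] K) ^ (q + 1)))
    (hα : nullity A < ⊤) (hβ : deficiency B < ⊤) (hC : Function.Bijective C) {W : Submodule ℂ H}
    (hW : IsCompl (LinearMap.range (A : H →ₗ[ℂ] H) ⊔ LinearMap.ker ((A : H →ₗ[ℂ] H) ^ p)) W)
    (hCW : ∀ y, C y ∈ W ↔
      y ∈ LinearMap.ker (B : K →ₗ[ℂ] K) ⊓ LinearMap.range ((B : K →ₗ[ℂ] K) ^ q)) :
    IsBrowder (upperTriangular A B C) := by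
  set N := LinearMap.ker ((A : H →ₗ[ℂ] H) ^ p) with hN
  set L := LinearMap.range ((B : K →ₗ[ℂ] K) ^ q) with hL
  clear_value N L
  refine isBrowder_of_filtration (X₁ := N.map (inclFst H K : H →ₗ[ℂ] WithLp 2 (H × K)))
    (X₂ := L.comap (projSnd H K : WithLp 2 (H × K) →ₗ[ℂ] K)) (p := p) (q := q)
    ?_ ?_ ?_ ?_ ?_ ?_ ?_ ?_
  · rintro _ ⟨n, hn, rfl⟩
    refine ⟨A n, ?_, by simpa using (upperTriangular_pow_inclFst A B C 1 n).symm⟩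
    rw [hp] at hn
    rwa [SetLike.mem_coe, hN, LinearMap.mem_ker, ← ContinuousLinearMap.coe_coe,
      ← Module.End.mul_apply, ← pow_succ]
  · intro v hv
    rw [mem_comap, hL] at hv ⊢
    obtain ⟨z, hz⟩ := hv
    have h : projSnd H K (upperTriangular A B C v) = (B : K →ₗ[ℂ] K) (projSnd H K v) := rfl
    refine ⟨B z, ?_⟩
    rw [ContinuousLinearMap.coe_coe] at hz
    rw [ContinuousLinearMap.coe_coe, h, ← hz, ← ContinuousLinearMap.coe_coe,
      ← Module.End.mul_apply, ← Module.End.mul_apply, ← pow_succ, ← pow_succ']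
  · rintro _ ⟨n, hn, rfl⟩
    rw [SetLike.mem_coe, hN] at hn
    rw [ContinuousLinearMap.coe_coe, upperTriangular_pow_inclFst, LinearMap.mem_ker.1 hn, map_zero]
  · intro v
    rw [mem_comap, hL, ContinuousLinearMap.coe_coe, projSnd_upperTriangular_pow]
    exact ⟨_, rfl⟩
  · refine (dim_le_of_surjective _
      ((inclFst H K : H →ₗ[ℂ] WithLp 2 (H × K)).submoduleMap_surjective N)).trans_lt ?_
    rw [hN]
    exact dim_ker_pow_lt_top _ hα p
  · refine (dim_quotient_comap (projSnd H K : WithLp 2 (H × K) →ₗ[ℂ] K) L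
      projSnd_surjective).trans_lt ?_
    rw [hL]
    exact dim_quotient_range_pow_lt_top _ hβ q
  -- Injectivity in between: `A x + C y ∈ N` and `B y = 0` put `C y` into `W` and into `R(A) + N`.
  · rintro v hv ⟨n, hn, hnv⟩
    obtain ⟨x, y, rfl⟩ := exists_eq_toLp v
    obtain ⟨e1, e2⟩ := Prod.mk_inj.1
      (show (n, 0) = (A x + C y, B y) from congrArg WithLp.ofLp hnv)
    have hy : y = 0 := by
      refine hC.1 ((disjoint_def.1 hW.disjoint _ ?_ ((hCW y).2 ⟨e2.symm, hv⟩)).trans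
        (map_zero C).symm)
      rw [show C y = -A x + n by rw [e1]; abel]
      exact add_mem (neg_mem (mem_sup_left ⟨x, rfl⟩)) (mem_sup_right hn)
    subst hy
    refine ⟨x, ?_, rfl⟩
    rw [map_zero, add_zero] at e1
    rw [SetLike.mem_coe, hN] at hn
    rw [SetLike.mem_coe, hp, LinearMap.mem_ker, pow_succ, Module.End.mul_apply,
      ContinuousLinearMap.coe_coe, ← e1]
    exact hn
  -- Surjectivity in between: lift `y` to `L` through `B`, split the remaining error in `H` along
  -- `(R(A) + N) ⊕ W`, and remove its `W` part by a vector of `N(B) ∩ L`.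
  · intro v hv
    obtain ⟨x, y, rfl⟩ := exists_eq_toLp v
    have hy : y ∈ L := hv
    rw [hq, pow_succ'] at hy
    obtain ⟨z, rfl⟩ := hy
    obtain ⟨r, hr, w, hw, hrw⟩ :=
      mem_sup.1 (hW.sup_eq_top.ge (mem_top : x - C (((B : K →ₗ[ℂ] K) ^ q) z) ∈ ⊤))
    obtain ⟨_, ⟨a, rfl⟩, n, hn, rfl⟩ := mem_sup.1 hr
    obtain ⟨u, rfl⟩ := hC.2 w
    obtain ⟨hu1, hu2⟩ := (hCW u).1 hw
    refine mem_sup.2 ⟨_, ⟨WithLp.toLp 2 (a, ((B : K →ₗ[ℂ] K) ^ q) z + u),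
      L.add_mem (by rw [hL]; exact ⟨z, rfl⟩) hu2, rfl⟩, _, ⟨n, hn, rfl⟩,
      congrArg (WithLp.toLp 2) (Prod.ext ?_ ?_)⟩
    · change A a + C (((B : K →ₗ[ℂ] K) ^ q) z + u) + n = x
      rw [map_add, ← sub_add_cancel x (C (((B : K →ₗ[ℂ] K) ^ q) z)), ← hrw]
      simp only [ContinuousLinearMap.coe_coe]
      abel
    · change B (((B : K →ₗ[ℂ] K) ^ q) z + u) + 0 = _
      rw [map_add, show B u = 0 from hu1, add_zero, add_zero]
      rfl

/-- If `A` is left semi-Browder, `B` is right semi-Browder and the nullities and deficiencies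
balance, then some invertible `C` makes `M_C` Browder. The balance says that `N(B) ∩ R(B ^ q)` and
`H ⧸ (R(A) + N(A ^ p))` have equal dimension. Taking for `C` an isomorphism between the first space
and `(R(A) + N(A ^ p))ᗮ`, it extends to an invertible operator because both orthogonal complements
are infinite-dimensional. -/
theorem exists_isInvertible_isBrowder_upperTriangular [CompleteSpace H] [CompleteSpace K]
    [TopologicalSpace.SeparableSpace H] [TopologicalSpace.SeparableSpace K]
    (hH : ¬ FiniteDimensional ℂ H) (hK : ¬ FiniteDimensional ℂ K)
    (hA : IsLeftSemiBrowder A) (hB : IsRightSemiBrowder B)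
    (hAB : nullity A + nullity B = deficiency A + deficiency B) :
    ∃ C : K →L[ℂ] H, C.IsInvertible ∧ IsBrowder (upperTriangular A B C) := by
  obtain ⟨⟨hRA, -, hα⟩, hasc⟩ := hA
  obtain ⟨⟨-, -, hβ⟩, hdes⟩ := hB
  obtain ⟨p, hp⟩ := ascent_lt_top_iff.1 hasc
  obtain ⟨q, hq⟩ := descent_lt_top_iff.1 hdes
  have hkA := dim_ker_add_dim_quotient_sup hα hp
  have hkB := dim_ker_inf_add_dim_quotient hβ hq
  set R := LinearMap.range (A : H →ₗ[ℂ] H) ⊔ LinearMap.ker ((A : H →ₗ[ℂ] H) ^ p) with hR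
  set U := LinearMap.ker (B : K →ₗ[ℂ] K) ⊓ LinearMap.range ((B : K →ₗ[ℂ] K) ^ q) with hU
  have hRc : IsClosed (R : Set H) := by
    have := dim_lt_top_iff.1 (dim_ker_pow_lt_top _ hα p)
    exact isClosed_sup_finiteDimensional _ _ hRA
  have hUc : IsClosed (U : Set K) := by
    refine B.isClosed_ker.inter ?_
    have h := dim_quotient_range_pow_lt_top _ hβ q
    rw [← ContinuousLinearMap.toLinearMap_pow] at h ⊢
    exact isClosed_range_of_dim_quotient_lt_top (B ^ q) h
  have := hRc.completeSpace_coe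
  have := hUc.completeSpace_coe
  have hdim : dim U = dim Rᗮ := by
    rw [← dim_congr (quotientEquivOfIsCompl R Rᗮ R.isCompl_orthogonal)]
    -- `α(A) + α(B) = α(A) + β(B) + dim U` and `β(A) + β(B) = α(A) + β(B) + dim (H ⧸ R)`.
    have h : (nullity A + deficiency B) + dim U = (nullity A + deficiency B) + dim (H ⧸ R) := by
      rw [nullity, nullity, deficiency, deficiency, ← hkA, ← hkB] at hAB
      rw [nullity, deficiency]
      calc _ = _ := by ring
        _ = _ := hAB
        _ = _ := by ring
    exact enat_add_left_cancel (ENat.add_lt_top.2 ⟨hα, hβ⟩).ne h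
  have hdim' : dim Uᗮ = dim Rᗮᗮ := by
    rw [R.orthogonal_orthogonal]
    -- Both complements are infinite-dimensional: otherwise `B` would have finite rank and finite
    -- deficiency, or `A` finite rank and finite nullity.
    trans ⊤
    · rw [← dim_congr (quotientEquivOfIsCompl U Uᗮ U.isCompl_orthogonal)]
      by_contra h
      refine hK (dim_lt_top_iff.1 ?_)
      rw [← dim_add_dim_quotient (LinearMap.range (B : K →ₗ[ℂ] K)),
        ← dim_congr (B : K →ₗ[ℂ] K).quotKerEquivRange]
      exact ENat.add_lt_top.2
        ⟨(dim_quotient_anti inf_le_left).trans_lt (lt_top_iff_ne_top.2 h), hβ⟩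
    · by_contra h
      refine hH (dim_lt_top_iff.1 ?_)
      rw [← dim_ker_add_dim_range (A : H →ₗ[ℂ] H)]
      exact ENat.add_lt_top.2
        ⟨hα, (dim_submodule_mono le_sup_left).trans_lt (lt_top_iff_ne_top.2 (Ne.symm h))⟩
  obtain ⟨C, hC⟩ := exists_continuousLinearEquiv_mem_iff hUc R.isClosed_orthogonal hdim hdim'
  exact ⟨C, ⟨C, rfl⟩,
    isBrowder_upperTriangular hp hq hα hβ C.bijective R.isCompl_orthogonal hC⟩

end UpperTriangular

end BrowderPerturbation

theorem theorem2p15 {H K : Type*}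
    [NormedAddCommGroup H] [InnerProductSpace ℂ H] [CompleteSpace H]
    [TopologicalSpace.SeparableSpace H] (hH : ¬ FiniteDimensional ℂ H)
    [NormedAddCommGroup K] [InnerProductSpace ℂ K] [CompleteSpace K]
    [TopologicalSpace.SeparableSpace K] (hK : ¬ FiniteDimensional ℂ K)
    (A : H →L[ℂ] H) (B : K →L[ℂ] K) :
    (⋂ C ∈ {C : K →L[ℂ] H | C.IsInvertible},
        BrowderPerturbation.browderSpectrum (BrowderPerturbation.upperTriangular A B C)) =
      (⋂ C ∈ {C : K →L[ℂ] H | BrowderPerturbation.IsFredholm C},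
        BrowderPerturbation.browderSpectrum (BrowderPerturbation.upperTriangular A B C)) ∧
    (⋂ C ∈ {C : K →L[ℂ] H | BrowderPerturbation.IsFredholm C},
        BrowderPerturbation.browderSpectrum (BrowderPerturbation.upperTriangular A B C)) =
      BrowderPerturbation.leftBrowderSpectrum A ∪ BrowderPerturbation.rightBrowderSpectrum B ∪
        {l : ℂ | BrowderPerturbation.nullity (BrowderPerturbation.shift A l) +
            BrowderPerturbation.nullity (BrowderPerturbation.shift B l) ≠
          BrowderPerturbation.deficiency (BrowderPerturbation.shift A l) +
            BrowderPerturbation.deficiency (BrowderPerturbation.shift B l)} := by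
  -- Invertible operators are Fredholm, so it suffices to bound the third set by the second and the
  -- first by the third.
  have hGΦ := Set.biInter_subset_biInter_left
    (t := fun C : K →L[ℂ] H =>
      BrowderPerturbation.browderSpectrum (BrowderPerturbation.upperTriangular A B C))
    (fun C hC => BrowderPerturbation.isFredholm_of_isInvertible hC :
      {C : K →L[ℂ] H | C.IsInvertible} ⊆ {C | BrowderPerturbation.IsFredholm C})
  have hΦ : (⋂ C ∈ {C : K →L[ℂ] H | BrowderPerturbation.IsFredholm C},
      BrowderPerturbation.browderSpectrum (BrowderPerturbation.upperTriangular A B C)) ⊇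
      BrowderPerturbation.leftBrowderSpectrum A ∪ BrowderPerturbation.rightBrowderSpectrum B ∪
        {l : ℂ | BrowderPerturbation.nullity (BrowderPerturbation.shift A l) +
            BrowderPerturbation.nullity (BrowderPerturbation.shift B l) ≠
          BrowderPerturbation.deficiency (BrowderPerturbation.shift A l) +
            BrowderPerturbation.deficiency (BrowderPerturbation.shift B l)} := by
    intro l hl
    refine Set.mem_iInter₂.2 fun C _ hC => ?_
    rw [BrowderPerturbation.shift_upperTriangular] at hC
    obtain ⟨h1, h2, h3⟩ := hC.of_upperTriangular
    rcases hl with (hl | hl) | hl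
    exacts [hl h1, hl h2, hl h3]
  have hG : (⋂ C ∈ {C : K →L[ℂ] H | C.IsInvertible},
      BrowderPerturbation.browderSpectrum (BrowderPerturbation.upperTriangular A B C)) ⊆
      BrowderPerturbation.leftBrowderSpectrum A ∪ BrowderPerturbation.rightBrowderSpectrum B ∪
        {l : ℂ | BrowderPerturbation.nullity (BrowderPerturbation.shift A l) +
            BrowderPerturbation.nullity (BrowderPerturbation.shift B l) ≠
          BrowderPerturbation.deficiency (BrowderPerturbation.shift A l) +
            BrowderPerturbation.deficiency (BrowderPerturbation.shift B l)} := by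
    intro l hl
    by_contra hn
    simp only [Set.mem_union, not_or] at hn
    obtain ⟨⟨h1, h2⟩, h3⟩ := hn
    obtain ⟨C, hC, hM⟩ :=
      BrowderPerturbation.exists_isInvertible_isBrowder_upperTriangular hH hK
        (not_not.1 h1) (not_not.1 h2) (not_not.1 h3)
    refine Set.mem_iInter₂.1 hl C hC ?_
    rwa [BrowderPerturbation.shift_upperTriangular]
  exact ⟨(hG.trans hΦ).antisymm hGΦ, (hGΦ.trans hG).antisymm hΦ⟩
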